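/- For a finite simple graph $G$ on a vertex set $V$, let $\mathcal{P}_G \subset \mathbb{R}^V$ be its symmetric edge polytope, i.e. the convex hull of the points $\pm(\mathbf{e}_i - \mathbf{e}_j)$ for all edges $\{i,j\}$ of $G$, where $\mathbf{e}_i$ are the unit coordinate vectors. Let $N(\mathcal{P})$ denote the number of facets of a polytope $\mathcal{P}$, i.e. of faces of dimension $\dim \mathcal{P} - 1$. The suspension $\widehat{G}$ of $G$ is the graph obtained from $G$ by adding one new vertex and joining it to all vertices of $G$. The join $G_1 + G_2$ of graphs $G_1 = (V, E)$ and $G_2 = (V', E')$ with $V \cap V' = \emptyset$ is the graph on $V \cup V'$ with edge set $E \cup E' \cup \{\{i,j\} : i \in V,\ j \in V'\}$. Lemma 4.1. Let $G_1 = (V,E)$ and $G_2 = (V',E')$ be finite simple graphs (not necessarily connected) with $V, V'$ nonempty, $V \cap V' = \emptyset$, $|V| = n_1$ and $|V'| = n_2$. For $i = 1, 2$, let $m_i$ be the number of connected components of $G_i$. Then $$N(\mathcal{P}_{G_1+G_2}) \le N(\mathcal{P}_{\widehat{G_1}}) + N(\mathcal{P}_{\widehat{G_2}}) + 2^{m_1}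 + 2^{m_2} - 2 + 4(2^{n_1-1}-1)(2^{n_2-1}-1).$$ -/

import Mathlib

namespace SymEdge

/-- The symmetric edge polytope of a graph `G` on `V`: the convex hull in `ℝ^V` of the points
`± (e_i - e_j)` for the edges `{i, j}` of `G`. Adjacency is symmetric, so both signs occur. -/
def symmetricEdgePolytope {V : Type*} (G : SimpleGraph V) : Set (V → ℝ) :=
  open Classical in
  convexHull ℝ {x | ∃ i j, G.Adj i j ∧ x = Pi.single i 1 - Pi.single j 1}

/-- `F` is a facet of the convex set `P` in `ℝ^V`: it is a nonempty face, that is, the set of the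
points of `P` at which some linear functional is maximal on `P`, and its dimension is
one less than the dimension of `P`. -/
def IsFacet {V : Type*} (P F : Set (V → ℝ)) : Prop :=
  F.Nonempty ∧ IsExposed ℝ P F ∧
    Module.finrank ℝ (vectorSpan ℝ F) + 1 = Module.finrank ℝ (vectorSpan ℝ P)

/-- The number of facets of `P`. -/
noncomputable def numFacets {V : Type*} (P : Set (V → ℝ)) : ℕ :=
  {F | IsFacet P F}.ncard

/-- A polytope has only finitely many facets, so `numFacets` is the honest number of them. -/
theorem finite_facets {V : Type*} [Finite V] {S : Set (V → ℝ)} (hS : S.Finite) :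
    {F | IsFacet (convexHull ℝ S) F}.Finite := by
  refine Set.Finite.of_finite_image (f := fun F => F.extremePoints ℝ)
    (hS.finite_subsets.subset ?_) ?_
  · rintro _ ⟨F, hF, rfl⟩
    exact (hF.2.1.isExtreme.extremePoints_subset_extremePoints).trans
      extremePoints_convexHull_subset
  · have key : ∀ F, IsFacet (convexHull ℝ S) F →
        closure (convexHull ℝ (F.extremePoints ℝ)) = F := fun F hF =>
      closure_convexHull_extremePoints (hF.2.1.isCompact (hS.isCompact_convexHull (𝕜 := ℝ)))
        (hF.2.1.convex (convex_convexHull ℝ S))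
    intro F hF F' hF' h
    rw [← key F hF, ← key F' hF']
    exact congrArg (fun T => closure (convexHull ℝ T)) h

/-- The join of two graphs on disjoint vertex sets: all edges of both graphs, and all edges between
a vertex of the one and a vertex of the other. -/
def graphJoin {V W : Type*} (G : SimpleGraph V) (H : SimpleGraph W) : SimpleGraph (V ⊕ W) where
  Adj
    | .inl a, .inl b => G.Adj a b
    | .inr a, .inr b => H.Adj a b
    | _, _ => True
  symm := ⟨by
    rintro (a | a) (b | b) h
    · exact SimpleGraph.Adj.symm (G := G) h
    · trivial
    · trivial
    · exact SimpleGraph.Adj.symm (G := H) h⟩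
  loopless := ⟨by
    rintro (a | a) h
    · exact G.loopless.irrefl a h
    · exact H.loopless.irrefl a h⟩

/-- The suspension of a graph: one new vertex `none` is added and joined to every old vertex. -/
def suspension {V : Type*} (G : SimpleGraph V) : SimpleGraph (Option V) where
  Adj
    | some a, some b => G.Adj a b
    | none, none => False
    | _, _ => True
  symm := ⟨by
    rintro (_ | a) (_ | b) h
    · exact h
    · trivial
    · trivial
    · exact SimpleGraph.Adj.symm (G := G) h⟩
  loopless := ⟨by
    rintro (_ | a) h
    · exact h
    · exact G.loopless.irrefl a h⟩

end SymEdge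

namespace SymEdge

/-! ### Facets of centrally symmetric polytopes. -/

section Polytope

variable {V : Type*} {S : Set (V → ℝ)}

/-! For connected `G` with an edge, facets of the polytope correspond to integer potentials `f` with
a fixed zero, changing by at most one along edges, whose tight edges (change exactly one) connect
all vertices (`bijOn_potentialFace`). In a join every left value is within one of every right value.
If `f` is constant on one side, contracting that side gives a facet potential of the suspension of
the other. Otherwise `f` takes just two consecutive values, both on each side (`exists_two_values`),
and is determined by where it is larger: a proper nonempty subset of each side, hence at most `(2 ^
n₁ - 2) * (2 ^ n₂ - 2)` choices. The remaining terms `2 ^ m₁ + 2 ^ m₂ - 2` are nonnegative. -/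

theorem linearMap_le_of_mem_convexHull {l : (V → ℝ) →ₗ[ℝ] ℝ} {c : ℝ} (h : ∀ s ∈ S, l s ≤ c)
    {x : V → ℝ} (hx : x ∈ convexHull ℝ S) : l x ≤ c :=
  convexHull_min (t := {y | l y ≤ c}) h (convex_halfSpace_le l.isLinear c) hx

theorem convexHull_subset_span (S : Set (V → ℝ)) :
    convexHull ℝ S ⊆ Submodule.span ℝ S :=
  convexHull_min Submodule.subset_span (Submodule.span ℝ S).convex

theorem zero_mem_convexHull_of_neg_mem (hneg : ∀ s ∈ S, -s ∈ S) (hne : S.Nonempty) :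
    (0 : V → ℝ) ∈ convexHull ℝ S := by
  obtain ⟨s, hs⟩ := hne
  have := (convex_convexHull ℝ S) (subset_convexHull ℝ S hs)
    (subset_convexHull ℝ S (hneg s hs)) (a := 1 / 2) (b := 1 / 2)
    (by norm_num) (by norm_num) (by norm_num)
  simpa using this

theorem vectorSpan_convexHull_of_neg_mem (hneg : ∀ s ∈ S, -s ∈ S) (hne : S.Nonempty) :
    vectorSpan ℝ (convexHull ℝ S) = Submodule.span ℝ S := by
  rw [vectorSpan_eq_span_vsub_set_right ℝ (zero_mem_convexHull_of_neg_mem hneg hne)]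
  simp only [vsub_eq_sub, sub_zero, Set.image_id']
  exact le_antisymm (Submodule.span_le.2 (convexHull_subset_span S))
    (Submodule.span_mono (subset_convexHull ℝ S))

/-- The linear span of a set in an affine hyperplane off the origin has one dimension more than the
set. -/
theorem finrank_span_of_eq_one [Finite V] {F : Set (V → ℝ)} (hF : F.Nonempty)
    {l : (V → ℝ) →ₗ[ℝ] ℝ} (hl : ∀ x ∈ F, l x = 1) :
    Module.finrank ℝ (Submodule.span ℝ F) = Module.finrank ℝ (vectorSpan ℝ F) + 1 := by
  obtain ⟨p, hp⟩ := hF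
  have hker : vectorSpan ℝ F ≤ LinearMap.ker l := by
    rw [vectorSpan_eq_span_vsub_set_right ℝ hp, Submodule.span_le]
    rintro _ ⟨x, hx, rfl⟩
    simp [hl x hx, hl p hp]
  have hpn : p ∉ vectorSpan ℝ F := fun h => by
    have : l p = 0 := hker h
    rw [hl p hp] at this
    exact one_ne_zero this
  rw [← Submodule.finrank_sup_span_singleton hpn]
  suffices h : Submodule.span ℝ F = vectorSpan ℝ F ⊔ Submodule.span ℝ {p} by rw [h]
  refine le_antisymm (Submodule.span_le.2 fun x hx => ?_) (sup_le ?_ ?_)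
  · have h1 : x - p ∈ vectorSpan ℝ F := vsub_mem_vectorSpan ℝ hx hp
    have := Submodule.add_mem_sup h1 (Submodule.mem_span_singleton_self (R := ℝ) p)
    simpa using this
  · rw [vectorSpan_eq_span_vsub_set_right ℝ hp, Submodule.span_le]
    rintro _ ⟨x, hx, rfl⟩
    exact Submodule.sub_mem _ (Submodule.subset_span hx) (Submodule.subset_span hp)
  · exact Submodule.span_mono (by simpa using hp)

/-- An exposed face of a polytope is spanned by the generators of the polytope that it contains. -/
theorem IsExposed.linearMap_eq_zero [Finite V] (hS : S.Finite) {F : Set (V → ℝ)}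
    (hF : IsExposed ℝ (convexHull ℝ S) F) {m : (V → ℝ) →ₗ[ℝ] ℝ}
    (hm : ∀ s ∈ S, s ∈ F → m s = 0) {x : V → ℝ} (hx : x ∈ F) : m x = 0 := by
  have key : closure (convexHull ℝ (F.extremePoints ℝ)) = F :=
    closure_convexHull_extremePoints (hF.isCompact (hS.isCompact_convexHull (𝕜 := ℝ)))
      (hF.convex (convex_convexHull ℝ S))
  have hsub : closure (convexHull ℝ (F.extremePoints ℝ)) ⊆ LinearMap.ker m := by
    refine closure_minimal (convexHull_min (fun y hy => ?_) (LinearMap.ker m).convex)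
      (LinearMap.ker m).closed_of_finiteDimensional
    exact hm y (extremePoints_convexHull_subset
      (hF.isExtreme.extremePoints_subset_extremePoints hy)) hy.1
  rw [key] at hsub
  exact hsub hx

/-- A facet of a centrally symmetric polytope is cut out by a functional which is at most `1` on the
polytope, and the generators at which it is `1` span the whole space of the polytope. -/
theorem IsFacet.exists_linearMap [Finite V] (hS : S.Finite) (hneg : ∀ s ∈ S, -s ∈ S)
    (hne : S.Nonempty) {F : Set (V → ℝ)} (hF : IsFacet (convexHull ℝ S) F) :
    ∃ l : (V → ℝ) →ₗ[ℝ] ℝ, (∀ s ∈ S, l s ≤ 1) ∧ F = {x ∈ convexHull ℝ S | l x = 1} ∧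
      ∀ m : (V → ℝ) →ₗ[ℝ] ℝ, (∀ s ∈ S, l s = 1 → m s = 0) → ∀ s ∈ S, m s = 0 := by
  obtain ⟨hFne, hexp, hdim⟩ := hF
  obtain ⟨l, hl⟩ := hexp hFne
  obtain ⟨p, hp⟩ := hFne
  have hpP : p ∈ convexHull ℝ S ∧ ∀ y ∈ convexHull ℝ S, l y ≤ l p := by rw [hl] at hp; exact hp
  have hFl : F = {x ∈ convexHull ℝ S | l x = l p} := by
    rw [hl]
    ext x
    exact ⟨fun h => ⟨h.1, le_antisymm (hpP.2 x h.1) (h.2 p hpP.1)⟩,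
      fun h => ⟨h.1, fun y hy => h.2 ▸ hpP.2 y hy⟩⟩
  have h0 := zero_mem_convexHull_of_neg_mem hneg hne
  -- If the maximum were `0`, symmetry would make `l` vanish on `S`, so `F` would be the whole
  -- polytope, of the wrong dimension.
  have hpos : 0 < l p := by
    refine lt_of_le_of_ne (by simpa using hpP.2 0 h0) fun hz => ?_
    have hSz : ∀ s ∈ S, l s = 0 := fun s hs => by
      have h1 := hpP.2 s (subset_convexHull ℝ S hs)
      have h2 := hpP.2 (-s) (subset_convexHull ℝ S (hneg s hs))
      rw [map_neg] at h2
      linarith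
    have hPF : F = convexHull ℝ S := by
      rw [hFl]
      refine Set.Subset.antisymm (fun x hx => hx.1) fun x hx => ⟨hx, ?_⟩
      have : convexHull ℝ S ⊆ LinearMap.ker (l : (V → ℝ) →ₗ[ℝ] ℝ) :=
        convexHull_min hSz (LinearMap.ker _).convex
      rw [← hz]
      exact this hx
    rw [hPF] at hdim
    omega
  refine ⟨(l p)⁻¹ • (l : (V → ℝ) →ₗ[ℝ] ℝ), fun s hs => ?_, ?_, fun m hm => ?_⟩
  · have := hpP.2 s (subset_convexHull ℝ S hs)
    simpa [inv_mul_le_iff₀ hpos] using this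
  · rw [hFl]
    ext x
    simp [inv_mul_eq_one₀ hpos.ne', eq_comm]
  · have hF1 : ∀ x ∈ F, ((l p)⁻¹ • (l : (V → ℝ) →ₗ[ℝ] ℝ)) x = 1 := fun x hx => by
      rw [hFl] at hx
      simp [hx.2, hpos.ne']
    have hspan : Submodule.span ℝ F = Submodule.span ℝ S := by
      refine Submodule.eq_of_le_of_finrank_eq (Submodule.span_le.2 ?_) ?_
      · exact fun x hx => convexHull_subset_span S (hexp.subset hx)
      · rw [finrank_span_of_eq_one ⟨p, hp⟩ hF1, hdim, vectorSpan_convexHull_of_neg_mem hneg hne]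
    have hle : Submodule.span ℝ F ≤ LinearMap.ker m := Submodule.span_le.2 fun x hx =>
      IsExposed.linearMap_eq_zero hS hexp (fun s hs hsF => hm s hs (hF1 s hsF)) hx
    rw [hspan] at hle
    exact fun s hs => hle (Submodule.subset_span hs)

/-- A functional that is at most `1` on a centrally symmetric polytope cuts out a facet if the
generators at which it is `1` span the whole space of the polytope. -/
theorem isFacet_of_linearMap [Finite V] (hneg : ∀ s ∈ S, -s ∈ S)
    {l : (V → ℝ) →ₗ[ℝ] ℝ} (hle : ∀ s ∈ S, l s ≤ 1) (hex : ∃ s ∈ S, l s = 1)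
    (hspan : ∀ m : (V → ℝ) →ₗ[ℝ] ℝ, (∀ s ∈ S, l s = 1 → m s = 0) → ∀ s ∈ S, m s = 0) :
    IsFacet (convexHull ℝ S) {x ∈ convexHull ℝ S | l x = 1} := by
  obtain ⟨s₀, hs₀, hls₀⟩ := hex
  have hFne : {x ∈ convexHull ℝ S | l x = 1}.Nonempty := ⟨s₀, subset_convexHull ℝ S hs₀, hls₀⟩
  refine ⟨hFne, fun _ => ⟨LinearMap.toContinuousLinearMap l, ?_⟩, ?_⟩
  · ext x
    refine ⟨fun h => ⟨h.1, fun y hy => ?_⟩, fun h => ⟨h.1, le_antisymm ?_ ?_⟩⟩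
    · simpa [h.2] using linearMap_le_of_mem_convexHull hle hy
    · exact linearMap_le_of_mem_convexHull hle h.1
    · simpa [hls₀] using h.2 s₀ (subset_convexHull ℝ S hs₀)
  · rw [← finrank_span_of_eq_one hFne (fun x hx => hx.2),
      vectorSpan_convexHull_of_neg_mem hneg ⟨s₀, hs₀⟩]
    suffices h : Submodule.span ℝ {x ∈ convexHull ℝ S | l x = 1} = Submodule.span ℝ S by rw [h]
    refine le_antisymm (Submodule.span_le.2 fun x hx => convexHull_subset_span S hx.1)
      (Submodule.span_le.2 fun s hs => ?_)
    by_contra hsn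
    obtain ⟨m, hms, hm⟩ := Submodule.exists_le_ker_of_notMem hsn
    exact hms (hspan m (fun t ht hlt =>
      hm (Submodule.subset_span ⟨subset_convexHull ℝ S ht, hlt⟩)) s hs)

end Polytope

end SymEdge
namespace SymEdge

/-! ### Facets as integer potentials. -/

section Graph

variable {V : Type*}

/-- The points `e_i - e_j` over the ordered edges of `G`, whose convex hull is the symmetric edge
polytope. -/
def edgeVectors (G : SimpleGraph V) : Set (V → ℝ) :=
  open Classical in {x | ∃ i j, G.Adj i j ∧ x = Pi.single i 1 - Pi.single j 1}

theorem symmetricEdgePolytope_eq (G : SimpleGraph V) :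
    symmetricEdgePolytope G = convexHull ℝ (edgeVectors G) := rfl

theorem neg_mem_edgeVectors (G : SimpleGraph V) : ∀ s ∈ edgeVectors G, -s ∈ edgeVectors G := by
  rintro _ ⟨i, j, h, rfl⟩
  exact ⟨j, i, h.symm, neg_sub _ _⟩

theorem finite_edgeVectors [Finite V] (G : SimpleGraph V) : (edgeVectors G).Finite := by
  classical
  refine (Set.finite_range
    fun p : V × V => (Pi.single p.1 1 - Pi.single p.2 1 : V → ℝ)).subset ?_
  rintro _ ⟨i, j, -, rfl⟩
  exact ⟨(i, j), by congr⟩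

/-- The spanning subgraph of the edges along which the potential `f` changes by exactly one. -/
def tightGraph (G : SimpleGraph V) (f : V → ℤ) : SimpleGraph V where
  Adj i j := G.Adj i j ∧ |f i - f j| = 1
  symm := ⟨fun i j h => ⟨h.1.symm, by rw [abs_sub_comm]; exact h.2⟩⟩
  loopless := ⟨fun i h => G.loopless.irrefl i h.1⟩

/-- The integral potentials, normalized to vanish at `r`, that describe the facets of the symmetric
edge polytope of a connected graph. -/
def facetPotentials (G : SimpleGraph V) (r : V) : Set (V → ℤ) :=
  {f | f r = 0 ∧ (∀ i j, G.Adj i j → |f i - f j| ≤ 1) ∧ (tightGraph G f).Preconnected}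

/-- The face of the symmetric edge polytope on which the potential `f` takes the value one. -/
def potentialFace [Fintype V] (G : SimpleGraph V) (f : V → ℤ) : Set (V → ℝ) :=
  {x ∈ symmetricEdgePolytope G | ∑ i, (f i : ℝ) * x i = 1}

/-- A function that takes equal values at adjacent vertices of a connected graph is constant. -/
theorem Preconnected.eq_of_adj {α : Type*} {G : SimpleGraph V} (hG : G.Preconnected) {f : V → α}
    (hf : ∀ i j, G.Adj i j → f i = f j) (i j : V) : f i = f j := by
  obtain ⟨p⟩ := hG i j
  induction p with
  | nil => rfl
  | cons h _ ih => exact (hf _ _ h).trans ih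

/-- The linear functional with given values at the unit vectors. -/
noncomputable def coeffFunctional [Fintype V] (a : V → ℝ) : (V → ℝ) →ₗ[ℝ] ℝ :=
  ∑ i, a i • LinearMap.proj i

theorem coeffFunctional_apply [Fintype V] (a x : V → ℝ) :
    coeffFunctional a x = ∑ i, a i * x i := by
  simp [coeffFunctional]

theorem coeffFunctional_single_sub [Fintype V] [DecidableEq V] (a : V → ℝ) (i j : V) :
    coeffFunctional a (Pi.single i 1 - Pi.single j 1) = a i - a j := by
  rw [map_sub]
  simp [coeffFunctional_apply, Pi.single_apply]

theorem eq_coeffFunctional [Fintype V] [DecidableEq V] (l : (V → ℝ) →ₗ[ℝ] ℝ) :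
    l = coeffFunctional fun i => l (Pi.single i 1) := by
  refine LinearMap.pi_ext' fun i => LinearMap.ext_ring ?_
  simp [coeffFunctional_apply, Pi.single_apply]

/-- Turns conditions on generators into conditions on edges; `b := 0` fills the second slot when
only one functional matters. -/
theorem forall_edgeVectors [Fintype V] {G : SimpleGraph V} {p : ℝ → ℝ → Prop} {a b : V → ℝ} :
    (∀ s ∈ edgeVectors G, p (coeffFunctional a s) (coeffFunctional b s)) ↔
      ∀ i j, G.Adj i j → p (a i - a j) (b i - b j) := by
  classical
  constructor
  · intro h i j hij
    have := h _ ⟨i, j, hij, rfl⟩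
    convert this using 1 <;> (symm; convert coeffFunctional_single_sub _ i j)
  · rintro h _ ⟨i, j, hij, rfl⟩
    have := h i j hij
    convert this using 1 <;> convert coeffFunctional_single_sub _ i j

theorem isFacet_potentialFace [Fintype V] {G : SimpleGraph V} {r : V} {f : V → ℤ}
    (hf : f ∈ facetPotentials G r) (hedge : ∃ i j, G.Adj i j) :
    IsFacet (symmetricEdgePolytope G) (potentialFace G f) := by
  classical
  obtain ⟨-, hle, hconn⟩ := hf
  have h1 : ∀ s ∈ edgeVectors G, coeffFunctional (fun i => (f i : ℝ)) s ≤ 1 := by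
    refine (forall_edgeVectors (p := fun x _ => x ≤ 1) (b := 0)).2 fun i j hij => ?_
    exact_mod_cast (le_abs_self _).trans (hle i j hij)
  have h2 : ∀ m : (V → ℝ) →ₗ[ℝ] ℝ,
      (∀ s ∈ edgeVectors G, coeffFunctional (fun i => (f i : ℝ)) s = 1 → m s = 0) →
      ∀ s ∈ edgeVectors G, m s = 0 := by
    intro m
    rw [eq_coeffFunctional m]
    generalize (fun i => m (Pi.single i 1)) = b
    intro hm
    have hm' := (forall_edgeVectors (p := fun x y => x = 1 → y = 0)).1 hm
    have hb : ∀ i j, b i = b j := Preconnected.eq_of_adj hconn fun i j hij => by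
      rcases (abs_eq zero_le_one).1 hij.2 with h | h
      · exact sub_eq_zero.1 (hm' i j hij.1 (by exact_mod_cast h))
      · exact (sub_eq_zero.1 (hm' j i hij.1.symm
          (by exact_mod_cast (by omega : f j - f i = 1)))).symm
    exact (forall_edgeVectors (p := fun x _ => x = 0) (b := 0)).2 fun i j _ =>
      sub_eq_zero.2 (hb i j)
  -- With no tight generator, `h2` is vacuous and would make a coordinate functional vanish on an
  -- edge at that coordinate.
  have h3 : ∃ s ∈ edgeVectors G, coeffFunctional (fun i => (f i : ℝ)) s = 1 := by
    by_contra! hno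
    obtain ⟨i, j, hij⟩ := hedge
    have := (forall_edgeVectors (p := fun x _ => x = 0) (b := 0)).1
      (h2 (coeffFunctional (Pi.single i 1)) fun s hs h => absurd h (hno s hs)) i j hij
    simp [hij.ne'] at this
  have := isFacet_of_linearMap (neg_mem_edgeVectors G) h1 h3 h2
  simp only [coeffFunctional_apply] at this
  exact this

/-- The face determines the tight edges and their orientation, so `f - g` is constant along the
connected tight graph of `f`, and it vanishes at `r`. -/
theorem potentialFace_injOn [Fintype V] (G : SimpleGraph V) (r : V) :
    Set.InjOn (potentialFace G) (facetPotentials G r) := by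
  classical
  intro f hf g hg hfg
  have h : ∀ s ∈ edgeVectors G, coeffFunctional (fun i => (f i : ℝ)) s = 1 →
      coeffFunctional (fun i => (g i : ℝ)) s = 1 := by
    intro s hs h1
    have : s ∈ potentialFace G f :=
      ⟨subset_convexHull ℝ _ hs, by rwa [coeffFunctional_apply] at h1⟩
    rw [hfg] at this
    rw [coeffFunctional_apply]
    exact this.2
  have h' := (forall_edgeVectors (p := fun x y => x = 1 → y = 1)).1 h
  have hstep : ∀ i j, G.Adj i j → f i - f j = 1 → g i - g j = 1 := fun i j hij h1 => by
    exact_mod_cast h' i j hij (by exact_mod_cast h1)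
  have hconst := Preconnected.eq_of_adj hf.2.2 (f := fun i => f i - g i) fun i j hij => by
    rcases (abs_eq zero_le_one).1 hij.2 with h | h
    · have := hstep i j hij.1 h
      lia
    · have := hstep j i hij.1.symm (by lia)
      lia
  funext i
  have := hconst i r
  have h1 := hf.1
  have h2 := hg.1
  lia

theorem exists_facetPotential [Fintype V] {G : SimpleGraph V} (hG : G.Preconnected)
    (hedge : ∃ i j, G.Adj i j) (r : V) {F : Set (V → ℝ)}
    (hF : IsFacet (symmetricEdgePolytope G) F) :
    ∃ f ∈ facetPotentials G r, potentialFace G f = F := by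
  classical
  have hne : (edgeVectors G).Nonempty := by
    obtain ⟨i, j, hij⟩ := hedge
    exact ⟨_, i, j, hij, rfl⟩
  obtain ⟨l, hle, hFl, hspan⟩ :=
    IsFacet.exists_linearMap (finite_edgeVectors G) (neg_mem_edgeVectors G) hne hF
  rw [eq_coeffFunctional l] at hle hFl hspan
  generalize (fun i => l (Pi.single i 1)) = a at hle hFl hspan
  have hle' : ∀ i j, G.Adj i j → a i - a j ≤ 1 :=
    (forall_edgeVectors (p := fun x _ => x ≤ 1) (b := 0)).1 hle
  let T : SimpleGraph V :=
    { Adj := fun i j => G.Adj i j ∧ |a i - a j| = 1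
      symm := ⟨fun i j h => ⟨h.1.symm, by rw [abs_sub_comm]; exact h.2⟩⟩
      loopless := ⟨fun i h => G.loopless.irrefl i h.1⟩ }
  -- The indicator of the tight component of `u` kills all tight generators, hence all generators,
  -- so it is constant on the connected `G`.
  have hT : T.Preconnected := by
    intro u v
    have hb := (forall_edgeVectors (G := G) (p := fun x _ => x = 0) (b := 0)).1
      (hspan (coeffFunctional fun i => if T.Reachable u i then 1 else 0)
        ((forall_edgeVectors (p := fun x y => x = 1 → y = 0)).2 fun i j hij h1 => by
          have hadj : T.Adj i j := ⟨hij, by rw [h1, abs_one]⟩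
          have : T.Reachable u i ↔ T.Reachable u j :=
            ⟨fun h => h.trans hadj.reachable, fun h => h.trans hadj.symm.reachable⟩
          simp [this]))
    have := Preconnected.eq_of_adj hG (fun i j hij => sub_eq_zero.1 (hb i j hij)) u v
    by_contra huv
    simp [huv] at this
  -- Each step of a tight path changes `a` by `1` or `-1`.
  have hint : ∀ i, ∃ z : ℤ, a i - a r = z := by
    intro i
    obtain ⟨p⟩ := hT i r
    induction p with
    | nil => exact ⟨0, by simp⟩
    | cons h _ ih =>
      obtain ⟨z, hz⟩ := ih
      rcases (abs_eq zero_le_one).1 h.2 with h' | h'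
      · exact ⟨z + 1, by push_cast; linarith⟩
      · exact ⟨z - 1, by push_cast; linarith⟩
  choose f hf using hint
  have hdiff : ∀ i j, ((f i - f j : ℤ) : ℝ) = a i - a j := fun i j => by
    push_cast
    rw [← hf i, ← hf j]
    ring
  have habs : ∀ i j, ((|f i - f j| : ℤ) : ℝ) = |a i - a j| := fun i j => by
    rw [Int.cast_abs, hdiff]
  have hTle : T ≤ tightGraph G f := fun i j hij => by
    have := hij.2
    rw [← habs] at this
    exact ⟨hij.1, by exact_mod_cast this⟩
  refine ⟨f, ⟨?_, fun i j hij => ?_, hT.mono hTle⟩, ?_⟩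
  · have := hf r
    rw [sub_self] at this
    exact_mod_cast this.symm
  · have : |a i - a j| ≤ 1 :=
      abs_le.2 ⟨by linarith [hle' j i hij.symm], hle' i j hij⟩
    rw [← habs] at this
    exact_mod_cast this
  · rw [hFl]
    ext x
    refine and_congr_right fun hx => ?_
    rw [← coeffFunctional_apply fun i => (f i : ℝ)]
    have hker : edgeVectors G ⊆
        LinearMap.ker (coeffFunctional (fun i => (f i : ℝ)) - coeffFunctional a) :=
      fun s hs => by
        simpa [sub_eq_zero] using (forall_edgeVectors (p := fun x y => x = y)).2
          (fun i j _ => by exact_mod_cast hdiff i j) s hs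
    have := convexHull_min hker (LinearMap.ker _).convex hx
    rw [SetLike.mem_coe, LinearMap.mem_ker, LinearMap.sub_apply, sub_eq_zero] at this
    rw [this]

/-- The facets of the symmetric edge polytope of a connected graph correspond to the facet
potentials of the graph. -/
theorem bijOn_potentialFace [Fintype V] {G : SimpleGraph V} (hG : G.Preconnected)
    (hedge : ∃ i j, G.Adj i j) (r : V) :
    Set.BijOn (potentialFace G) (facetPotentials G r) {F | IsFacet (symmetricEdgePolytope G) F} :=
  ⟨fun _ hf => isFacet_potentialFace hf hedge, potentialFace_injOn G r,
    fun _ hF => exists_facetPotential hG hedge r hF⟩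

theorem finite_facetPotentials [Fintype V] {G : SimpleGraph V} (hG : G.Preconnected)
    (hedge : ∃ i j, G.Adj i j) (r : V) : (facetPotentials G r).Finite :=
  (bijOn_potentialFace hG hedge r).finite_iff_finite.2 (finite_facets (finite_edgeVectors G))

theorem numFacets_eq_ncard [Fintype V] {G : SimpleGraph V} (hG : G.Preconnected)
    (hedge : ∃ i j, G.Adj i j) (r : V) :
    numFacets (symmetricEdgePolytope G) = (facetPotentials G r).ncard := by
  rw [numFacets, ← (bijOn_potentialFace hG hedge r).image_eq,
    (potentialFace_injOn G r).ncard_image]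

end Graph

end SymEdge
namespace SymEdge

/-! ### Potentials on joins and suspensions. -/

section Join

variable {V W : Type*}

theorem preconnected_suspension (G : SimpleGraph V) : (suspension G).Preconnected := by
  have h : ∀ x : Option V, (suspension G).Reachable none x
    | none => .refl _
    | some v => SimpleGraph.Adj.reachable (G := suspension G) (u := none) (v := some v) trivial
  exact fun x y => (h x).symm.trans (h y)

theorem preconnected_graphJoin [Nonempty V] [Nonempty W] (G : SimpleGraph V)
    (H : SimpleGraph W) : (graphJoin G H).Preconnected := by
  have hadj : ∀ v w, (graphJoin G H).Reachable (.inl v) (.inr w) := fun v w =>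
    SimpleGraph.Adj.reachable (G := graphJoin G H) (u := .inl v) (v := .inr w) trivial
  obtain ⟨v₀⟩ := ‹Nonempty V›
  obtain ⟨w₀⟩ := ‹Nonempty W›
  have h : ∀ x : V ⊕ W, (graphJoin G H).Reachable (.inl v₀) x
    | .inl v => (hadj v₀ w₀).trans (hadj v w₀).symm
    | .inr w => hadj v₀ w
  exact fun x y => (h x).symm.trans (h y)

/-- Facet potentials descend along a surjection of the vertices that keeps the edges with distinct
potentials and is compatible with the bounds on the edges of the image. -/
theorem mem_facetPotentials_of_surjective {G : SimpleGraph V} {H : SimpleGraph W} {r : V} {s : W}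
    {f : V → ℤ} (hf : f ∈ facetPotentials G r) {φ : V → W} (hφ : Function.Surjective φ)
    {g : W → ℤ} {c : ℤ} (hg : ∀ v, g (φ v) = f v - c) (hs : g s = 0)
    (hadj : ∀ i j, G.Adj i j → f i ≠ f j → H.Adj (φ i) (φ j))
    (hlift : ∀ i j, H.Adj i j → ∃ i' j', φ i' = i ∧ φ j' = j ∧ G.Adj i' j') :
    g ∈ facetPotentials H s := by
  refine ⟨hs, fun i j hij => ?_, ?_⟩
  · obtain ⟨i, j, rfl, rfl, hij'⟩ := hlift i j hij
    rw [hg, hg, sub_sub_sub_cancel_right]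
    exact hf.2.1 i j hij'
  · let ψ : tightGraph G f →g tightGraph H g :=
      ⟨φ, fun {i j} hij => ⟨hadj i j hij.1 fun h => by simpa [h] using hij.2, by
        rw [hg, hg, sub_sub_sub_cancel_right]; exact hij.2⟩⟩
    exact hf.2.2.map ψ hφ

theorem ncard_constant_inr_le [Fintype V] [Nonempty V] (G : SimpleGraph V) (H : SimpleGraph W)
    (w₀ : W) :
    {f ∈ facetPotentials (graphJoin G H) (.inr w₀) |
      ∀ w w', f (.inr w) = f (.inr w')}.ncard ≤ (facetPotentials (suspension G) none).ncard := by
  obtain ⟨v₀⟩ := ‹Nonempty V›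
  refine Set.ncard_le_ncard_of_injOn
    (fun f x => x.elim 0 fun v => f (.inl v)) ?_ ?_
    (finite_facetPotentials (preconnected_suspension G) ⟨none, some v₀, trivial⟩ none)
  · rintro f ⟨hf, hc⟩
    refine mem_facetPotentials_of_surjective hf (φ := Sum.elim some fun _ => none) (c := 0)
      ?_ ?_ rfl ?_ ?_
    · rintro (_ | v)
      · exact ⟨.inr w₀, rfl⟩
      · exact ⟨.inl v, rfl⟩
    · rintro (v | w)
      · simp
      · simpa [hf.1] using (hc w w₀).symm
    · rintro (i | i) (j | j) hij hne
      · exact hij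
      · trivial
      · trivial
      · exact hne (hc i j)
    · rintro (_ | i) (_ | j) hij
      · exact hij.elim
      · exact ⟨.inr w₀, .inl j, rfl, rfl, trivial⟩
      · exact ⟨.inl i, .inr w₀, rfl, rfl, trivial⟩
      · exact ⟨.inl i, .inl j, rfl, rfl, hij⟩
  · rintro f ⟨hf, hfc⟩ g ⟨hg, hgc⟩ hfg
    funext x
    rcases x with v | w
    · exact congrFun hfg (some v)
    · rw [hfc w w₀, hgc w w₀, hf.1, hg.1]

theorem ncard_constant_inl_le [Fintype W] [Nonempty V] (G : SimpleGraph V) (H : SimpleGraph W)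
    (w₀ : W) :
    {f ∈ facetPotentials (graphJoin G H) (.inr w₀) |
      ∀ v v', f (.inl v) = f (.inl v')}.ncard ≤ (facetPotentials (suspension H) none).ncard := by
  obtain ⟨v₀⟩ := ‹Nonempty V›
  refine Set.ncard_le_ncard_of_injOn
    -- The zero `w₀` lies on the side that is kept, so the contracted side must be shifted to zero;
    -- `f (.inr w₀) = 0` recovers the shift.
    (fun f x => x.elim 0 fun w => f (.inr w) - f (.inl v₀)) ?_ ?_
    (finite_facetPotentials (preconnected_suspension H) ⟨none, some w₀, trivial⟩ none)
  · rintro f ⟨hf, hc⟩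
    refine mem_facetPotentials_of_surjective hf (φ := Sum.elim (fun _ => none) some)
      (c := f (.inl v₀)) ?_ ?_ rfl ?_ ?_
    · rintro (_ | w)
      · exact ⟨.inl v₀, rfl⟩
      · exact ⟨.inr w, rfl⟩
    · rintro (v | w)
      · simpa [sub_eq_zero] using (sub_eq_zero.2 (hc v v₀)).symm
      · simp
    · rintro (i | i) (j | j) hij hne
      · exact hne (hc i j)
      · trivial
      · trivial
      · exact hij
    · rintro (_ | i) (_ | j) hij
      · exact hij.elim
      · exact ⟨.inl v₀, .inr j, rfl, rfl, trivial⟩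
      · exact ⟨.inr i, .inl v₀, rfl, rfl, trivial⟩
      · exact ⟨.inr i, .inr j, rfl, rfl, hij⟩
  · rintro f ⟨hf, hfc⟩ g ⟨hg, hgc⟩ hfg
    have hw : ∀ w, f (.inr w) - f (.inl v₀) = g (.inr w) - g (.inl v₀) :=
      fun w => congrFun hfg (some w)
    have h₀ := hw w₀
    rw [hf.1, hg.1] at h₀
    funext x
    rcases x with v | w
    · have := hfc v v₀
      have := hgc v v₀
      lia
    · have := hw w
      lia

/-- A potential on a join that is constant on neither side takes exactly two values, which are
consecutive and attained on both sides. -/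
theorem exists_two_values {G : SimpleGraph V} {H : SimpleGraph W} {f : V ⊕ W → ℤ}
    (hf : ∀ i j, (graphJoin G H).Adj i j → |f i - f j| ≤ 1)
    (hV : ¬ ∀ v v', f (.inl v) = f (.inl v')) (hW : ¬ ∀ w w', f (.inr w) = f (.inr w')) :
    ∃ a, (∀ x, f x = a ∨ f x = a + 1) ∧ (∃ v, f (.inl v) = a) ∧ (∃ v, f (.inl v) = a + 1) ∧
      (∃ w, f (.inr w) = a) ∧ ∃ w, f (.inr w) = a + 1 := by
  have h : ∀ v w, |f (.inl v) - f (.inr w)| ≤ 1 := fun v w => hf _ _ trivial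
  simp only [abs_le] at h
  obtain ⟨v₁, v₂, hv⟩ : ∃ v₁ v₂, f (.inl v₁) < f (.inl v₂) := by
    by_contra! hno
    exact hV fun v v' => le_antisymm (hno v' v) (hno v v')
  obtain ⟨w₁, w₂, hw⟩ : ∃ w₁ w₂, f (.inr w₁) < f (.inr w₂) := by
    by_contra! hno
    exact hW fun w w' => le_antisymm (hno w' w) (hno w w')
  have h11 := h v₁ w₁
  have h12 := h v₁ w₂
  have h21 := h v₂ w₁
  have h22 := h v₂ w₂
  -- The cycle `f v₂ - 1 ≤ f w₁ ≤ f w₂ - 1 ≤ f v₁ ≤ f v₂ - 1` forces equalities; any other vertex is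
  -- within one of both values on the opposite side.
  refine ⟨f (.inl v₁), ?_, ⟨v₁, rfl⟩, ⟨v₂, by lia⟩, ⟨w₁, by lia⟩, ⟨w₂, by lia⟩⟩
  rintro (v | w)
  · have := h v w₁
    have := h v w₂
    lia
  · have := h v₁ w
    have := h v₂ w
    lia

theorem ncard_proper_nonempty [Fintype V] [Nonempty V] :
    (({∅, Set.univ} : Set (Set V))ᶜ).ncard = 2 * (2 ^ (Fintype.card V - 1) - 1) := by
  have h1 := Set.ncard_add_ncard_compl ({∅, Set.univ} : Set (Set V))
  rw [Set.ncard_pair Set.empty_ne_univ, Nat.card_eq_fintype_card, Fintype.card_set] at h1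
  obtain ⟨n, hn⟩ := Nat.exists_eq_succ_of_ne_zero (Fintype.card_ne_zero (α := V))
  rw [hn, pow_succ] at h1
  rw [hn, Nat.succ_sub_one]
  lia

theorem ncard_nonconstant_le [Fintype V] [Fintype W] [Nonempty V] (G : SimpleGraph V)
    (H : SimpleGraph W) (w₀ : W) :
    {f ∈ facetPotentials (graphJoin G H) (.inr w₀) | (¬ ∀ v v', f (.inl v) = f (.inl v')) ∧
      ¬ ∀ w w', f (.inr w) = f (.inr w')}.ncard ≤
      (2 * (2 ^ (Fintype.card V - 1) - 1)) * (2 * (2 ^ (Fintype.card W - 1) - 1)) := by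
  have : Nonempty W := ⟨w₀⟩
  rw [← ncard_proper_nonempty, ← ncard_proper_nonempty, ← Set.ncard_prod]
  refine Set.ncard_le_ncard_of_injOn
    -- These are the vertices with the larger value, described without naming that value.
    (fun f => ({v | ∃ x, f x < f (.inl v)}, {w | ∃ x, f x < f (.inr w)})) ?_ ?_
    (Set.toFinite _)
  · rintro f ⟨hf, hV, hW⟩
    obtain ⟨a, ha, ⟨v₁, hv₁⟩, ⟨v₂, hv₂⟩, ⟨w₁, hw₁⟩, ⟨w₂, hw₂⟩⟩ := exists_two_values hf.2.1 hV hW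
    simp only [Set.mem_prod, Set.mem_compl_iff, Set.mem_insert_iff, Set.mem_singleton_iff, not_or,
      Set.eq_empty_iff_forall_notMem, Set.eq_univ_iff_forall, Set.mem_ofPred_eq, not_forall,
      not_not]
    refine ⟨⟨⟨v₂, .inl v₁, by lia⟩, v₁, ?_⟩, ⟨w₂, .inl v₁, by lia⟩, w₁, ?_⟩
    all_goals
      rintro ⟨x, hx⟩
      have := ha x
      lia
  · have upper : ∀ f : V ⊕ W → ℤ, ∀ a, (∀ x, f x = a ∨ f x = a + 1) → (∃ v, f (.inl v) = a) →
        ∀ y, (∃ x, f x < f y) ↔ f y = a + 1 := by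
      rintro f a ha ⟨v, hv⟩ y
      constructor
      · rintro ⟨x, hx⟩
        have := ha x
        have := ha y
        lia
      · exact fun hy => ⟨.inl v, by lia⟩
    rintro f ⟨hf, hV, hW⟩ g ⟨hg, hV', hW'⟩ hfg
    obtain ⟨a, ha, hav, -⟩ := exists_two_values hf.2.1 hV hW
    obtain ⟨b, hb, hbv, -⟩ := exists_two_values hg.2.1 hV' hW'
    simp only [Prod.mk.injEq, Set.ext_iff, Set.mem_ofPred_eq, upper f a ha hav,
      upper g b hb hbv] at hfg
    have h : ∀ y, f y = a + 1 ↔ g y = b + 1 := Sum.forall.2 hfg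
    have h₀ := h (.inr w₀)
    have ha₀ := ha (.inr w₀)
    have hb₀ := hb (.inr w₀)
    rw [hf.1] at h₀ ha₀
    rw [hg.1] at h₀ hb₀
    -- Both potentials vanish at `w₀`, which has the larger value for both or for neither.
    have hab : a = b := by lia
    subst hab
    funext y
    have := h y
    have := ha y
    have := hb y
    lia

/-- A facet potential of a join is constant on one side, and then it comes from a suspension, or it
is determined by a proper nonempty subset of each side. Which of these subsets do occur depends on
the connected components of the two graphs; this bound counts them all. -/
theorem numFacets_graphJoin_le [Fintype V] [Fintype W] [Nonempty V] [Nonempty W]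
    (G : SimpleGraph V) (H : SimpleGraph W) :
    numFacets (symmetricEdgePolytope (graphJoin G H)) ≤
      numFacets (symmetricEdgePolytope (suspension G)) +
        numFacets (symmetricEdgePolytope (suspension H)) +
        (2 * (2 ^ (Fintype.card V - 1) - 1)) * (2 * (2 ^ (Fintype.card W - 1) - 1)) := by
  obtain ⟨v₀⟩ := id ‹Nonempty V›
  obtain ⟨w₀⟩ := id ‹Nonempty W›
  rw [numFacets_eq_ncard (preconnected_graphJoin G H) ⟨.inl v₀, .inr w₀, trivial⟩ (.inr w₀),
    numFacets_eq_ncard (preconnected_suspension G) ⟨none, some v₀, trivial⟩ none,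
    numFacets_eq_ncard (preconnected_suspension H) ⟨none, some w₀, trivial⟩ none]
  refine le_trans ?_ (add_le_add (add_le_add (ncard_constant_inr_le G H w₀)
    (ncard_constant_inl_le G H w₀)) (ncard_nonconstant_le G H w₀))
  refine le_trans ?_ ((Set.ncard_union_le _ _).trans
    (Nat.add_le_add_right (Set.ncard_union_le _ _) _))
  have hfin := finite_facetPotentials (preconnected_graphJoin G H)
    ⟨.inl v₀, .inr w₀, trivial⟩ (.inr w₀)
  refine Set.ncard_le_ncard (fun f hf => ?_) (hfin.subset ?_)
  · by_cases hW : ∀ w w', f (.inr w) = f (.inr w')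
    · exact .inl (.inl ⟨hf, hW⟩)
    · by_cases hV : ∀ v v', f (.inl v) = f (.inl v')
      · exact .inl (.inr ⟨hf, hV⟩)
      · exact .inr ⟨hf, hV, hW⟩
  · rintro f ((hf | hf) | hf) <;> exact hf.1

end Join

end SymEdge

theorem lemma4p1 {V W : Type*} [Fintype V] [Fintype W] [Nonempty V] [Nonempty W]
    (G₁ : SimpleGraph V) (G₂ : SimpleGraph W) (n₁ n₂ m₁ m₂ : ℕ)
    (hn₁ : Fintype.card V = n₁) (hn₂ : Fintype.card W = n₂)
    (hm₁ : Nat.card G₁.ConnectedComponent = m₁) (hm₂ : Nat.card G₂.ConnectedComponent = m₂) :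
    (SymEdge.numFacets (SymEdge.symmetricEdgePolytope (SymEdge.graphJoin G₁ G₂)) : ℤ) ≤
      SymEdge.numFacets (SymEdge.symmetricEdgePolytope (SymEdge.suspension G₁)) +
        SymEdge.numFacets (SymEdge.symmetricEdgePolytope (SymEdge.suspension G₂)) +
        2 ^ m₁ + 2 ^ m₂ - 2 + 4 * (2 ^ (n₁ - 1) - 1) * (2 ^ (n₂ - 1) - 1) := by
  have h := SymEdge.numFacets_graphJoin_le G₁ G₂
  rw [hn₁, hn₂] at h
  zify at h
  rw [Nat.cast_sub Nat.one_le_two_pow, Nat.cast_sub Nat.one_le_two_pow] at h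
  push_cast at h
  -- The component counts enter only through `2 ^ m₁ + 2 ^ m₂ ≥ 2`.
  have h₁ : (1 : ℤ) ≤ 2 ^ m₁ := one_le_pow₀ one_le_two
  have h₂ : (1 : ℤ) ≤ 2 ^ m₂ := one_le_pow₀ one_le_two
  linarith
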